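/- **Setting.** For $d\ge 1$, a complete set of local orthogonal observables on $\mathbb C^d$ is a family of $d^2$ Hermitian matrices $A_i$ with $\mathrm{tr}(A_iA_j)=\delta_{ij}$. For a state $\varrho$ and observables $M_\alpha$, the covariance matrix is $$\gamma(\varrho,\{M_\alpha\})_{\alpha\beta}=\tfrac12\langle M_\alpha M_\beta+M_\beta M_\alpha\rangle_\varrho-\langle M_\alpha\rangle_\varrho\langle M_\beta\rangle_\varrho .$$ For a bipartite state, $\gamma(\varrho)$ is taken with respect to $\{A_i\otimes\mathbb 1,\ \mathbb 1\otimes B_j\}$, where $\{A_i\},\{B_j\}$ are complete sets of local orthogonal observables of the two parties. A pair $(\kappa_A,\kappa_B)$ is admissible if $\kappa_A=\sum_k p_k\gamma(|\psi_k\rangle\langle\psi_k|,\{A_i\})$ and $\kappa_B=\sum_k p_k\gamma(|\phi_k\rangle\langle\phi_k|,\{B_j\})$ for finitely many convex weights $p_k$ (common to both sums) and unit vectors $\psi_k,\phi_k$. The state $\varrho$ satisfies the covariance matrix criterion (CMC), i.e. is not detected by it, if $\gamma(\varrho)-\kappa_A\oplus\kappa_B\ge 0$ for some admissible pair; otherwise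 it is detected by the CMC. The entanglement parameter is $$\mathcal E(\varrho)=1-V(\varrho),\qquad V(\varrho)=\max\{t\le 1:\ \gamma(\varrho)-t\,\kappa_A\oplus\kappa_B\ge 0\ \text{for some admissible } \kappa_A,\kappa_B\}.$$ An LOCC protocol is a finite adaptive sequence of local measurements of the two parties. Each measurement is given by Kraus operators $K_i$ with $\sum_iK_i^\dagger K_i=\mathbb 1$, and its outcome is communicated. A final outcome with accumulated local operators $F,G$ occurs with probability $p=\mathrm{tr}[(F\otimes G)\varrho(F\otimes G)^\dagger]$ and leaves the state $(F\otimes G)\varrho(F\otimes G)^\dagger/p$. **Lemma (Increasing on average under LOCC).** In the product basis $00,01,10,11$ let $$\varrho=\begin{pmatrix}0.48508&0&0&0.02094\\0&0.33&0&0\\0&0&0.00067&0\\0.02094&0&0&0.18425\end{pmatrix},$$ $$F_A=\mathrm{diag}(0.16457,\,0.98637),\quad F_B=\mathrm{diag}(0.96526,\,0.26128),\quad F_A^c=(\mathbb 1-F_A^2)^{1/2},\quad F_B^c=(\mathbb 1-F_B^2)^{1/2}.$$ Then, for every choice of complete sets of local orthogonal observables of the two qubits: 1. $\varrho$ is a two-qubit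 state that is NPT (its partial transpose is not positive semidefinite), hence not separable. It is not detected by the CMC, and $\mathcal E(\varrho)=0$. 2. $F_A^c,F_B^c$ are positive semidefinite square roots of $\mathbb 1-F_A^2,\ \mathbb 1-F_B^2$. The protocol in which the first party measures with Kraus operators $\{F_A,F_A^c\}$ and the second with $\{F_B,F_B^c\}$ is a valid LOCC protocol with the four outcomes $(F_A,F_B),(F_A,F_B^c),(F_A^c,F_B),(F_A^c,F_B^c)$. Each outcome $i$ has probability $p_i>0$ and leaves a state $\varrho_i$. 3. The filtered state $\varrho_{\rm filt}=\varrho_1$, obtained with $(F_A,F_B)$, is detected by the CMC, and $\mathcal E(\varrho_{\rm filt})>0$. 4. $0=\mathcal E(\varrho)<\sum_{i=1}^4p_i\,\mathcal E(\varrho_i)$. Hence $\mathcal E$ can increase on average under LOCC, from zero to a positive value. -/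

import Mathlib

open scoped Kronecker ComplexOrder

namespace CMC

/-! ### States -/

/-- A density matrix: positive semidefinite with unit trace. -/
def IsState {n : Type*} [Fintype n] (ρ : Matrix n n ℂ) : Prop :=
  ρ.PosSemidef ∧ ρ.trace = 1

/-- `v` is a unit vector for the standard Hermitian inner product. -/
def IsUnitVec {n : Type*} [Fintype n] (v : n → ℂ) : Prop :=
  star v ⬝ᵥ v = 1

/-- The rank-one matrix `|v⟩⟨v|`. -/
def ketbra {n : Type*} (v : n → ℂ) : Matrix n n ℂ :=
  Matrix.vecMulVec v (star v)

/-- Separability: `ρ` is a finite convex combination of pure product states. -/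
def IsSeparable {a b : ℕ} (ρ : Matrix (Fin a × Fin b) (Fin a × Fin b) ℂ) : Prop :=
  ∃ (n : ℕ) (p : Fin n → ℝ) (ψ : Fin n → Fin a → ℂ) (φ : Fin n → Fin b → ℂ),
    (∀ k, 0 ≤ p k) ∧ ∑ k, p k = 1 ∧ (∀ k, IsUnitVec (ψ k)) ∧ (∀ k, IsUnitVec (φ k)) ∧
      ρ = ∑ k, (p k : ℂ) • (ketbra (ψ k) ⊗ₖ ketbra (φ k))

/-- Partial transposition with respect to the second party. -/
def partialTranspose {a b : ℕ} (ρ : Matrix (Fin a × Fin b) (Fin a × Fin b) ℂ) :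
    Matrix (Fin a × Fin b) (Fin a × Fin b) ℂ :=
  Matrix.of fun x y => ρ (x.1, y.2) (y.1, x.2)

/-- NPT: the partial transpose is not positive semidefinite. -/
def IsNPT {a b : ℕ} (ρ : Matrix (Fin a × Fin b) (Fin a × Fin b) ℂ) : Prop :=
  ¬ (partialTranspose ρ).PosSemidef

/-! ### Covariance matrices and the covariance matrix criterion -/

/-- A complete set of local orthogonal observables on `ℂ^d`: `d ^ 2` Hermitian matrices with
`tr (A_i A_j) = δ_ij`. -/
structure LOO (d : ℕ) where
  obs : Fin (d ^ 2) → Matrix (Fin d) (Fin d) ℂ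
  hermitian : ∀ i, (obs i).IsHermitian
  orthonormal : ∀ i j, (obs i * obs j).trace = if i = j then 1 else 0

/-- The expectation value `⟨M⟩_ρ = tr (ρ M)`, a real number for Hermitian `ρ` and `M`. -/
noncomputable def expect {n : Type*} [Fintype n] (ρ M : Matrix n n ℂ) : ℝ :=
  (ρ * M).trace.re

/-- The covariance matrix
`γ(ρ, {M_α})_{αβ} = ½ ⟨M_α M_β + M_β M_α⟩_ρ - ⟨M_α⟩_ρ ⟨M_β⟩_ρ`. -/
noncomputable def covMatrix {n ι : Type*} [Fintype n] (ρ : Matrix n n ℂ)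
    (M : ι → Matrix n n ℂ) : Matrix ι ι ℝ :=
  Matrix.of fun α β =>
    (1 / 2) * expect ρ (M α * M β + M β * M α) - expect ρ (M α) * expect ρ (M β)

/-- The observables `{A_i ⊗ 1, 1 ⊗ B_j}`. -/
def jointObs {a b : ℕ} (A : LOO a) (B : LOO b) :
    Fin (a ^ 2) ⊕ Fin (b ^ 2) → Matrix (Fin a × Fin b) (Fin a × Fin b) ℂ :=
  Sum.elim (fun i => A.obs i ⊗ₖ 1) (fun j => 1 ⊗ₖ B.obs j)

/-- The covariance matrix of a bipartite state for the observables `{A_i ⊗ 1, 1 ⊗ B_j}`. -/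
noncomputable def bipartiteCov {a b : ℕ} (A : LOO a) (B : LOO b)
    (ρ : Matrix (Fin a × Fin b) (Fin a × Fin b) ℂ) :
    Matrix (Fin (a ^ 2) ⊕ Fin (b ^ 2)) (Fin (a ^ 2) ⊕ Fin (b ^ 2)) ℝ :=
  covMatrix ρ (jointObs A B)

/-- The pairs `(κ_A, κ_B)` with `κ_A = ∑ p_k γ(|ψ_k⟩⟨ψ_k|)`, `κ_B = ∑ p_k γ(|φ_k⟩⟨φ_k|)` for
convex weights `p_k` (the same in both sums) and pure states `ψ_k`, `φ_k`. -/
def IsKappaPair {a b : ℕ} (A : LOO a) (B : LOO b)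
    (κA : Matrix (Fin (a ^ 2)) (Fin (a ^ 2)) ℝ) (κB : Matrix (Fin (b ^ 2)) (Fin (b ^ 2)) ℝ) :
    Prop :=
  ∃ (n : ℕ) (p : Fin n → ℝ) (ψ : Fin n → Fin a → ℂ) (φ : Fin n → Fin b → ℂ),
    (∀ k, 0 ≤ p k) ∧ ∑ k, p k = 1 ∧ (∀ k, IsUnitVec (ψ k)) ∧ (∀ k, IsUnitVec (φ k)) ∧
      κA = ∑ k, p k • covMatrix (ketbra (ψ k)) A.obs ∧
      κB = ∑ k, p k • covMatrix (ketbra (φ k)) B.obs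

/-- `ρ` satisfies the covariance matrix criterion (is *not detected* by it):
`γ(ρ) ≥ κ_A ⊕ κ_B` for some admissible `κ_A, κ_B`. -/
def SatisfiesCMC {a b : ℕ} (A : LOO a) (B : LOO b)
    (ρ : Matrix (Fin a × Fin b) (Fin a × Fin b) ℂ) : Prop :=
  ∃ κA κB, IsKappaPair A B κA κB ∧
    (bipartiteCov A B ρ - Matrix.fromBlocks κA 0 0 κB).PosSemidef

/-- The set of `t ≤ 1` with `γ(ρ) - t κ_A ⊕ κ_B ≥ 0` for some admissible `κ_A, κ_B`. -/
def feasible {a b : ℕ} (A : LOO a) (B : LOO b)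
    (ρ : Matrix (Fin a × Fin b) (Fin a × Fin b) ℂ) : Set ℝ :=
  {t | t ≤ 1 ∧ ∃ κA κB, IsKappaPair A B κA κB ∧
    (bipartiteCov A B ρ - t • Matrix.fromBlocks κA 0 0 κB).PosSemidef}

/-- `V(ρ)`, the maximum of `feasible A B ρ` (for states the maximum exists: `isGreatest_V`). -/
noncomputable def V {a b : ℕ} (A : LOO a) (B : LOO b)
    (ρ : Matrix (Fin a × Fin b) (Fin a × Fin b) ℂ) : ℝ :=
  sSup (feasible A B ρ)

/-- The entanglement parameter `𝓔(ρ) = 1 - V(ρ)`. -/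
noncomputable def entParam {a b : ℕ} (A : LOO a) (B : LOO b)
    (ρ : Matrix (Fin a × Fin b) (Fin a × Fin b) ℂ) : ℝ :=
  1 - V A B ρ

/-! ### The maximum in the definition of `V` exists -/

section Attained

open Matrix

lemma covMatrix_posSemidef {n ι : Type*} [Fintype n] [DecidableEq n] [Fintype ι]
    {ρ : Matrix n n ℂ} (hρ : IsState ρ) {M : ι → Matrix n n ℂ}
    (hM : ∀ i, (M i).IsHermitian) : (covMatrix ρ M).PosSemidef := by
  refine Matrix.PosSemidef.of_dotProduct_mulVec_nonneg ?_ ?_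
  · ext i j
    simp [covMatrix, add_comm, mul_comm (expect ρ (M i))]
  · intro x
    set c : ℝ := ∑ i, x i * expect ρ (M i) with hc
    set X : Matrix n n ℂ := ∑ i, (x i : ℂ) • M i with hX
    have hXh : X.IsHermitian := by
      unfold Matrix.IsHermitian
      rw [hX, Matrix.conjTranspose_sum]
      refine Finset.sum_congr rfl fun i _ => ?_
      rw [Matrix.conjTranspose_smul, (hM i).eq]
      simp
    have h1 : expect ρ X = c := by
      simp [expect, hX, hc, Matrix.mul_sum, Matrix.trace_sum]
    have h2 : expect ρ (X * X) =
        ∑ i, ∑ j, x i * x j * expect ρ (M i * M j) := by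
      simp only [expect, hX, Matrix.sum_mul, Matrix.trace_sum, Matrix.smul_mul,
        Matrix.mul_smul, Matrix.trace_smul, Complex.re_sum, smul_eq_mul,
        Complex.re_ofReal_mul, Finset.mul_sum]
      rw [Finset.sum_comm]
      refine Finset.sum_congr rfl fun i _ => Finset.sum_congr rfl fun j _ => ?_
      ring
    have h3 : star x ⬝ᵥ covMatrix ρ M *ᵥ x = expect ρ (X * X) - c ^ 2 := by
      have e1 : star x ⬝ᵥ covMatrix ρ M *ᵥ x =
          ∑ i, ∑ j, ((1 / 2) * (x i * x j * expect ρ (M i * M j)) +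
            (1 / 2) * (x j * x i * expect ρ (M j * M i)) -
            (x i * expect ρ (M i)) * (x j * expect ρ (M j))) := by
        simp only [dotProduct, Matrix.mulVec, Finset.mul_sum]
        refine Finset.sum_congr rfl fun i _ => Finset.sum_congr rfl fun j _ => ?_
        have : expect ρ (M i * M j + M j * M i) =
            expect ρ (M i * M j) + expect ρ (M j * M i) := by
          simp [expect, Matrix.mul_add]
        simp only [covMatrix, Matrix.of_apply, this, Pi.star_apply, star_trivial]
        ring
      rw [e1]
      simp only [Finset.sum_sub_distrib, Finset.sum_add_distrib]
      rw [Finset.sum_comm (f := fun i j => (1 / 2) * (x j * x i * expect ρ (M j * M i)))]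
      rw [h2, hc, sq, Finset.sum_mul_sum]
      simp only [← Finset.mul_sum]
      ring
    have h4 : 0 ≤ expect ρ ((X - (c : ℂ) • 1) * (X - (c : ℂ) • 1)) := by
      set Z := X - (c : ℂ) • (1 : Matrix n n ℂ) with hZ
      have hZh : Zᴴ = Z := by
        rw [hZ, Matrix.conjTranspose_sub, hXh.eq, Matrix.conjTranspose_smul]; simp
      have := (hρ.1.mul_mul_conjTranspose_same Z).trace_nonneg
      have h5 : (Z * ρ * Zᴴ).trace = (ρ * (Z * Z)).trace := by
        rw [hZh, Matrix.mul_assoc, Matrix.trace_mul_comm, Matrix.mul_assoc]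
      rw [h5] at this
      exact (Complex.le_def.1 this).1
    have h6 : expect ρ ((X - (c : ℂ) • 1) * (X - (c : ℂ) • 1)) =
        expect ρ (X * X) - c ^ 2 := by
      have ht : ρ.trace = 1 := hρ.2
      have : expect ρ ((X - (c : ℂ) • 1) * (X - (c : ℂ) • 1)) =
          expect ρ (X * X) - 2 * c * expect ρ X + c ^ 2 := by
        simp [expect, Matrix.mul_sub, Matrix.sub_mul, ht]
        ring
      rw [this, h1]; ring
    rw [h3, ← h6]
    exact h4

lemma jointObs_isHermitian {a b : ℕ} (A : LOO a) (B : LOO b) (i) :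
    (jointObs A B i).IsHermitian := by
  rcases i with i | j
  · simp [jointObs, Matrix.IsHermitian, Matrix.conjTranspose_kronecker, (A.hermitian i).eq]
  · simp [jointObs, Matrix.IsHermitian, Matrix.conjTranspose_kronecker, (B.hermitian j).eq]

lemma continuous_covMatrix_ketbra {n ι : Type*} [Fintype n] (M : ι → Matrix n n ℂ) :
    Continuous fun v : n → ℂ => covMatrix (ketbra v) M := by
  have : ∀ X : Matrix n n ℂ, Continuous fun v : n → ℂ => expect (ketbra v) X := by
    intro X
    unfold expect ketbra
    refine Complex.continuous_re.comp (Continuous.matrix_trace (Continuous.matrix_mul ?_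
      continuous_const))
    exact Continuous.matrix_vecMulVec continuous_id continuous_star
  refine continuous_matrix fun i j => ?_
  simp only [covMatrix, Matrix.of_apply]
  exact (continuous_const.mul (this _)).sub ((this _).mul (this _))

lemma isCompact_unitVec (n : Type*) [Fintype n] :
    IsCompact {v : n → ℂ | IsUnitVec v} := by
  refine Metric.isCompact_of_isClosed_isBounded ?_ ?_
  · exact isClosed_eq (continuous_star.dotProduct continuous_id) continuous_const
  · refine (Metric.isBounded_closedBall (x := (0 : n → ℂ)) (r := 1)).subset fun v hv => ?_
    rw [mem_closedBall_zero_iff, pi_norm_le_iff_of_nonneg zero_le_one]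
    intro i
    have h : (∑ j, ‖v j‖ ^ 2 : ℝ) = 1 := by
      have h' : star v ⬝ᵥ v = 1 := hv
      have : ((∑ j, ‖v j‖ ^ 2 : ℝ) : ℂ) = star v ⬝ᵥ v := by
        simp [dotProduct, Complex.conj_mul']
      rw [h'] at this
      exact_mod_cast this
    have h2 : ‖v i‖ ^ 2 ≤ 1 := h ▸ Finset.single_le_sum (f := fun j => ‖v j‖ ^ 2)
      (fun j _ => by positivity) (Finset.mem_univ i)
    nlinarith [norm_nonneg (v i)]

lemma isCompact_convexHull {E : Type*} [AddCommGroup E] [Module ℝ E] [FiniteDimensional ℝ E]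
    [TopologicalSpace E] [IsTopologicalAddGroup E] [ContinuousSMul ℝ E] {s : Set E}
    (hs : IsCompact s) : IsCompact (convexHull ℝ s) := by
  set N := Module.finrank ℝ E + 1
  have key : convexHull ℝ s = (fun x : (Fin N → ℝ) × (Fin N → E) => ∑ i, x.1 i • x.2 i) ''
      (stdSimplex ℝ (Fin N) ×ˢ Set.pi Set.univ fun _ => s) := by
    ext x
    constructor
    · intro hx
      obtain ⟨ι, _, z, w, hz, hi, hw, hs1, hx⟩ := eq_pos_convex_span_of_mem_convexHull hx
      have hne : Nonempty ι := by
        by_contra h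
        rw [not_nonempty_iff] at h
        simp at hs1
      have hcard : Fintype.card ι ≤ Fintype.card (Fin N) := by
        rw [Fintype.card_fin]
        exact hi.card_le_finrank_succ.trans (Nat.succ_le_succ (Submodule.finrank_le _))
      obtain ⟨f⟩ := Function.Embedding.nonempty_of_card_le hcard
      have hinv := Function.leftInverse_invFun f.injective
      have hzero : ∀ i : Fin N, i ∉ Set.range f → Function.extend f w 0 i = 0 := fun i hi => by
        rw [Function.extend_apply' _ _ _ fun ⟨a, ha⟩ => hi ⟨a, ha⟩]; rfl
      refine ⟨(Function.extend f w 0, fun i => z (Function.invFun f i)), ⟨⟨fun i => ?_, ?_⟩,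
        fun i _ => hz ⟨_, rfl⟩⟩, ?_⟩
      · by_cases h : i ∈ Set.range f
        · obtain ⟨a, rfl⟩ := h
          simpa [f.injective.extend_apply] using (hw a).le
        · exact (hzero i h).ge
      · rw [← hs1]
        exact (Fintype.sum_of_injective f f.injective _ _ hzero
          fun a => by rw [f.injective.extend_apply]).symm
      · rw [← hx]
        refine (Fintype.sum_of_injective f f.injective _ _ (fun i h => ?_) fun a => ?_).symm
        · simp only [hzero i h, zero_smul]
        · simp only [f.injective.extend_apply, hinv a]
    · rintro ⟨⟨w, z⟩, ⟨hw, hz⟩, rfl⟩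
      exact mem_convexHull_of_exists_fintype w z hw.1 hw.2 (fun i => hz i trivial) rfl
  rw [key]
  refine ((isCompact_stdSimplex ℝ (Fin N)).prod (isCompact_univ_pi fun _ => hs)).image ?_
  fun_prop

lemma isCompact_kappa {a b : ℕ} (A : LOO a) (B : LOO b) :
    IsCompact {κ : Matrix (Fin (a ^ 2)) (Fin (a ^ 2)) ℝ × Matrix (Fin (b ^ 2)) (Fin (b ^ 2)) ℝ |
      IsKappaPair A B κ.1 κ.2} := by
  have key : {κ : Matrix (Fin (a ^ 2)) (Fin (a ^ 2)) ℝ × Matrix (Fin (b ^ 2)) (Fin (b ^ 2)) ℝ |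
      IsKappaPair A B κ.1 κ.2} =
      convexHull ℝ ((fun w : (Fin a → ℂ) × (Fin b → ℂ) =>
        (covMatrix (ketbra w.1) A.obs, covMatrix (ketbra w.2) B.obs)) ''
          ({v | IsUnitVec v} ×ˢ {v | IsUnitVec v})) := by
    ext κ
    constructor
    · rintro ⟨n, p, ψ, φ, hp, hs, hψ, hφ, h1, h2⟩
      refine mem_convexHull_of_exists_fintype p
        (fun k => (covMatrix (ketbra (ψ k)) A.obs, covMatrix (ketbra (φ k)) B.obs)) hp hs
        (fun k => ⟨(ψ k, φ k), ⟨hψ k, hφ k⟩, rfl⟩) ?_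
      ext1
      · rw [Prod.fst_sum, h1]; rfl
      · rw [Prod.snd_sum, h2]; rfl
    · intro h
      obtain ⟨ι, _, w, z, hw, hs, hz, hx⟩ := mem_convexHull_iff_exists_fintype.1 h
      choose y hy hyz using hz
      have e := (Fintype.equivFin ι).symm
      refine ⟨Fintype.card ι, fun k => w (e k), fun k => (y (e k)).1, fun k => (y (e k)).2,
        fun k => hw _, ?_, fun k => (hy _).1, fun k => (hy _).2, ?_, ?_⟩
      · rw [e.sum_comp w, hs]
      · rw [e.sum_comp (fun k => w k • covMatrix (ketbra (y k).1) A.obs), ← hx, Prod.fst_sum]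
        exact Finset.sum_congr rfl fun k _ => by rw [← hyz k]; rfl
      · rw [e.sum_comp (fun k => w k • covMatrix (ketbra (y k).2) B.obs), ← hx, Prod.snd_sum]
        exact Finset.sum_congr rfl fun k _ => by rw [← hyz k]; rfl
  rw [key]
  refine isCompact_convexHull (((isCompact_unitVec _).prod (isCompact_unitVec _)).image ?_)
  exact ((continuous_covMatrix_ketbra _).comp continuous_fst).prodMk
    ((continuous_covMatrix_ketbra _).comp continuous_snd)

lemma isClosed_posSemidef (n : Type*) [Fintype n] :
    IsClosed {M : Matrix n n ℝ | M.PosSemidef} := by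
  simp only [Matrix.posSemidef_iff_dotProduct_mulVec, Set.ofPred_and, Set.ofPred_forall]
  refine (isClosed_eq continuous_id.matrix_conjTranspose continuous_id).inter
    (isClosed_iInter fun x => isClosed_le continuous_const ?_)
  exact Continuous.dotProduct continuous_const (continuous_id.matrix_mulVec continuous_const)

/-- For states the maximum in the definition of `V` is attained. -/
theorem isGreatest_V {a b : ℕ} (A : LOO a) (B : LOO b)
    {ρ : Matrix (Fin a × Fin b) (Fin a × Fin b) ℂ} (hρ : IsState ρ) :
    IsGreatest (feasible A B ρ) (V A B ρ) := by
  have hne : Nonempty (Fin a × Fin b) := by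
    by_contra h
    rw [not_nonempty_iff] at h
    have := hρ.2
    simp [Matrix.trace] at this
  obtain ⟨i0, j0⟩ := hne
  have hbdd : BddAbove (feasible A B ρ) := ⟨1, fun t ht => ht.1⟩
  have h0 : (0 : ℝ) ∈ feasible A B ρ := by
    refine ⟨zero_le_one, _, _, ⟨1, fun _ => 1, fun _ => Pi.single i0 1, fun _ => Pi.single j0 1,
      by simp, by simp, by simp [IsUnitVec], by simp [IsUnitVec], rfl, rfl⟩, ?_⟩
    rw [zero_smul, sub_zero]
    exact covMatrix_posSemidef hρ (jointObs_isHermitian A B)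
  have hT : IsCompact ((fun x : ℝ × (Matrix (Fin (a ^ 2)) (Fin (a ^ 2)) ℝ ×
      Matrix (Fin (b ^ 2)) (Fin (b ^ 2)) ℝ) => x.1) ''
      ((Set.Icc (0 : ℝ) 1 ×ˢ {κ | IsKappaPair A B κ.1 κ.2}) ∩
        {x | (bipartiteCov A B ρ - x.1 • Matrix.fromBlocks x.2.1 0 0 x.2.2).PosSemidef})) := by
    refine IsCompact.image ?_ continuous_fst
    refine (isCompact_Icc.prod (isCompact_kappa A B)).inter_right
      ((isClosed_posSemidef _).preimage ?_)
    refine continuous_const.sub (continuous_fst.smul ?_)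
    exact Continuous.matrix_fromBlocks (continuous_fst.comp continuous_snd) continuous_const
      continuous_const (continuous_snd.comp continuous_snd)
  have hmem : ∀ t, 0 ≤ t → (t ∈ feasible A B ρ ↔ t ∈ ((fun x : ℝ ×
      (Matrix (Fin (a ^ 2)) (Fin (a ^ 2)) ℝ × Matrix (Fin (b ^ 2)) (Fin (b ^ 2)) ℝ) => x.1) ''
      ((Set.Icc (0 : ℝ) 1 ×ˢ {κ | IsKappaPair A B κ.1 κ.2}) ∩
        {x | (bipartiteCov A B ρ - x.1 • Matrix.fromBlocks x.2.1 0 0 x.2.2).PosSemidef}))) := by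
    intro t ht
    constructor
    · rintro ⟨h1, κA, κB, hk, hp⟩
      exact ⟨(t, κA, κB), ⟨⟨⟨ht, h1⟩, hk⟩, hp⟩, rfl⟩
    · rintro ⟨⟨s, κA, κB⟩, ⟨⟨hs, hk⟩, hp⟩, rfl⟩
      exact ⟨hs.2, κA, κB, hk, hp⟩
  obtain ⟨m, hm, hmax⟩ := hT.exists_isGreatest ⟨0, (hmem 0 le_rfl).1 h0⟩
  have hm0 : 0 ≤ m := hmax ((hmem 0 le_rfl).1 h0)
  have hg : IsGreatest (feasible A B ρ) m := by
    refine ⟨(hmem m hm0).2 hm, fun t ht => ?_⟩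
    rcases le_total 0 t with h | h
    · exact hmax ((hmem t h).1 ht)
    · exact h.trans hm0
  rw [V, hg.csSup_eq]
  exact hg

end Attained

/-! ### LOCC protocols -/

/-- A finite LOCC protocol in which every measurement outcome is recorded and communicated:
either stop, or one party performs a local measurement with Kraus operators `K i`, and the
protocol `next i` to follow may depend on the outcome `i`. -/
inductive LOCC (a b : ℕ) : Type
  | done : LOCC a b
  | alice (n : ℕ) (K : Fin n → Matrix (Fin a) (Fin a) ℂ) (next : Fin n → LOCC a b) : LOCC a b
  | bob (n : ℕ) (K : Fin n → Matrix (Fin b) (Fin b) ℂ) (next : Fin n → LOCC a b) : LOCC a b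

namespace LOCC

/-- Every local measurement is complete: `∑ i, (K i)† (K i) = 1`. -/
def IsValid {a b : ℕ} : LOCC a b → Prop
  | done => True
  | alice _ K next => ∑ i, (K i).conjTranspose * K i = 1 ∧ ∀ i, (next i).IsValid
  | bob _ K next => ∑ i, (K i).conjTranspose * K i = 1 ∧ ∀ i, (next i).IsValid

/-- The final outcomes, each given by the pair `(F, G)` of the accumulated Kraus operators of the
two parties; the outcome acts as `ρ ↦ (F ⊗ G) ρ (F ⊗ G)†`. -/
def outcomes {a b : ℕ} :
    LOCC a b → List (Matrix (Fin a) (Fin a) ℂ × Matrix (Fin b) (Fin b) ℂ)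
  | done => [(1, 1)]
  | alice _ K next =>
      (List.ofFn fun i => (next i).outcomes.map fun FG => (FG.1 * K i, FG.2)).flatten
  | bob _ K next =>
      (List.ofFn fun i => (next i).outcomes.map fun FG => (FG.1, FG.2 * K i)).flatten

end LOCC

/-- The unnormalised state `(F ⊗ G) ρ (F ⊗ G)†`. -/
def filter {a b : ℕ} (F : Matrix (Fin a) (Fin a) ℂ) (G : Matrix (Fin b) (Fin b) ℂ)
    (ρ : Matrix (Fin a × Fin b) (Fin a × Fin b) ℂ) : Matrix (Fin a × Fin b) (Fin a × Fin b) ℂ :=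
  (F ⊗ₖ G) * ρ * (F ⊗ₖ G).conjTranspose

/-- The probability `tr ((F ⊗ G) ρ (F ⊗ G)†)` of an outcome. -/
noncomputable def prob {a b : ℕ} (F : Matrix (Fin a) (Fin a) ℂ) (G : Matrix (Fin b) (Fin b) ℂ)
    (ρ : Matrix (Fin a × Fin b) (Fin a × Fin b) ℂ) : ℝ :=
  (filter F G ρ).trace.re

/-- The normalised state after an outcome (of non-zero probability). -/
noncomputable def postState {a b : ℕ} (F : Matrix (Fin a) (Fin a) ℂ)
    (G : Matrix (Fin b) (Fin b) ℂ) (ρ : Matrix (Fin a × Fin b) (Fin a × Fin b) ℂ) :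
    Matrix (Fin a × Fin b) (Fin a × Fin b) ℂ :=
  ((prob F G ρ : ℂ)⁻¹) • filter F G ρ

/-- The average `∑ i, p_i f(ρ_i)` of a function `f` over the outcomes of an LOCC protocol applied
to `ρ`. -/
noncomputable def LOCC.average {a b : ℕ} (P : LOCC a b)
    (f : Matrix (Fin a × Fin b) (Fin a × Fin b) ℂ → ℝ)
    (ρ : Matrix (Fin a × Fin b) (Fin a × Fin b) ℂ) : ℝ :=
  (P.outcomes.map fun FG => prob FG.1 FG.2 ρ * f (postState FG.1 FG.2 ρ)).sum

/-! ### The example -/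

/-- The two-qubit state of the example, in the product basis `00, 01, 10, 11`. -/
noncomputable def rhoEx : Matrix (Fin 2 × Fin 2) (Fin 2 × Fin 2) ℂ :=
  Matrix.reindex finProdFinEquiv.symm finProdFinEquiv.symm
    (!![0.48508, 0, 0, 0.02094;
        0, 0.33, 0, 0;
        0, 0, 0.00067, 0;
        0.02094, 0, 0, 0.18425] : Matrix (Fin 4) (Fin 4) ℂ)

noncomputable def filterA : Matrix (Fin 2) (Fin 2) ℂ := !![0.16457, 0; 0, 0.98637]

noncomputable def filterB : Matrix (Fin 2) (Fin 2) ℂ := !![0.96526, 0; 0, 0.26128]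

/-- The complementary filter `(1 - F_A F_A)^{1/2}`. -/
noncomputable def filterAc : Matrix (Fin 2) (Fin 2) ℂ :=
  !![(√(1 - 0.16457 ^ 2) : ℝ), 0; 0, (√(1 - 0.98637 ^ 2) : ℝ)]

/-- The complementary filter `(1 - F_B F_B)^{1/2}`. -/
noncomputable def filterBc : Matrix (Fin 2) (Fin 2) ℂ :=
  !![(√(1 - 0.96526 ^ 2) : ℝ), 0; 0, (√(1 - 0.26128 ^ 2) : ℝ)]

/-- The local filtering protocol: the first party measures with Kraus operators `F_A, F_A^c` and
the second party with `F_B, F_B^c`. -/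
noncomputable def filterProtocol : LOCC 2 2 :=
  .alice 2 ![filterA, filterAc] fun _ => .bob 2 ![filterB, filterBc] fun _ => .done

end CMC

namespace CMC

/-! ### Covariance matrices as variances -/

section Variance

open Matrix

/-! The quadratic form of a covariance matrix is a variance, and local orthogonal observables span
the Hermitian matrices. So the criterion asks for one ensemble `(p_k, ψ_k, φ_k)` such that, for all
Hermitian `H`, `K`, the variance of `H ⊗ 1 + 1 ⊗ K` in `ρ` is at least the average of `Var_ψ_k H +
Var_φ_k K`. The choice of observables thus drops out. For states in X form both sides are explicit
quadratic forms in Pauli coefficients.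

The mechanism is a mismatch between two thresholds. An X-state is NPT as soon as `z² > d₁ d₂` (with
`d₂ > 0`), while `not_satisfiesCMC_xState` needs `4z + (d₀ - d₁ - d₂ + d₃) > 1`, which at unit trace
means `2z > d₁ + d₂`. Diagonal filters multiply `z²` and `d₁ d₂` by the same factor, but they can
balance `d₁` against `d₂`, and then the two thresholds nearly agree. In `rhoEx` the entries 0.33 and
0.00067 are very unequal, and an explicit ensemble shows that the state escapes detection
(`satisfiesCMC_rhoEx`). The filters make them almost equal, and the result is detected
(`not_satisfiesCMC_filtered`).

Since the maximum defining `V` is attained, the parameter vanishes exactly on undetected states. All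
terms of the average are nonnegative and the first one is positive. -/

/-- The variance `⟨X²⟩_ρ - ⟨X⟩_ρ²`. -/
noncomputable def variance {n : Type*} [Fintype n] (ρ X : Matrix n n ℂ) : ℝ :=
  expect ρ (X * X) - expect ρ X ^ 2

lemma dotProduct_covMatrix_mulVec {n ι : Type*} [Fintype n] [Fintype ι]
    (ρ : Matrix n n ℂ) (M : ι → Matrix n n ℂ) (x : ι → ℝ) :
    x ⬝ᵥ covMatrix ρ M *ᵥ x = variance ρ (∑ i, (x i : ℂ) • M i) := by
  have h1 : expect ρ (∑ i, (x i : ℂ) • M i) = ∑ i, x i * expect ρ (M i) := by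
    simp [expect, Matrix.mul_sum, Matrix.trace_sum]
  have h2 : expect ρ ((∑ i, (x i : ℂ) • M i) * ∑ i, (x i : ℂ) • M i) =
      ∑ i, ∑ j, x i * x j * expect ρ (M i * M j) := by
    simp only [expect, Matrix.sum_mul, Matrix.trace_sum, Matrix.smul_mul,
      Matrix.mul_smul, Matrix.trace_smul, Complex.re_sum, smul_eq_mul,
      Complex.re_ofReal_mul, Finset.mul_sum]
    rw [Finset.sum_comm]
    refine Finset.sum_congr rfl fun i _ => Finset.sum_congr rfl fun j _ => ?_
    ring
  have e1 : x ⬝ᵥ covMatrix ρ M *ᵥ x =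
      ∑ i, ∑ j, ((1 / 2) * (x i * x j * expect ρ (M i * M j)) +
        (1 / 2) * (x j * x i * expect ρ (M j * M i)) -
        (x i * expect ρ (M i)) * (x j * expect ρ (M j))) := by
    simp only [dotProduct, Matrix.mulVec, Finset.mul_sum]
    refine Finset.sum_congr rfl fun i _ => Finset.sum_congr rfl fun j _ => ?_
    have : expect ρ (M i * M j + M j * M i) =
        expect ρ (M i * M j) + expect ρ (M j * M i) := by
      simp [expect, Matrix.mul_add]
    simp only [covMatrix, Matrix.of_apply, this]
    ring
  rw [e1]
  simp only [Finset.sum_sub_distrib, Finset.sum_add_distrib]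
  rw [Finset.sum_comm (f := fun i j => (1 / 2) * (x j * x i * expect ρ (M j * M i)))]
  rw [variance, h2, h1, sq, Finset.sum_mul_sum]
  simp only [← Finset.mul_sum]
  ring

lemma dotProduct_sum_covMatrix_mulVec {m ι κ : Type*} [Fintype m] [Fintype ι] [Fintype κ]
    (p : κ → ℝ) (ρ : κ → Matrix m m ℂ) (M : ι → Matrix m m ℂ) (x : ι → ℝ) :
    x ⬝ᵥ (∑ k, p k • covMatrix (ρ k) M) *ᵥ x =
      ∑ k, p k * variance (ρ k) (∑ i, (x i : ℂ) • M i) := by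
  rw [Matrix.sum_mulVec, dotProduct_sum]
  refine Finset.sum_congr rfl fun k _ => ?_
  rw [Matrix.smul_mulVec, dotProduct_smul, dotProduct_covMatrix_mulVec, smul_eq_mul]

lemma sum_jointObs {a b : ℕ} (A : LOO a) (B : LOO b) (x : Fin (a ^ 2) → ℝ)
    (y : Fin (b ^ 2) → ℝ) :
    ∑ i, ((Sum.elim x y i : ℝ) : ℂ) • jointObs A B i =
      (∑ i, (x i : ℂ) • A.obs i) ⊗ₖ (1 : Matrix (Fin b) (Fin b) ℂ) +
        (1 : Matrix (Fin a) (Fin a) ℂ) ⊗ₖ ∑ j, (y j : ℂ) • B.obs j := by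
  rw [Fintype.sum_sum_type]
  congr 1
  · ext ⟨i, j⟩ ⟨k, l⟩
    simp [jointObs, Matrix.sum_apply, Finset.sum_mul, mul_assoc]
  · ext ⟨i, j⟩ ⟨k, l⟩
    simp [jointObs, Matrix.sum_apply, Finset.mul_sum, mul_left_comm]

/-- Turns the matrix inequality of the criterion into an inequality between variances of local
observables. Both directions of the example go through this form. -/
lemma dotProduct_bipartiteCov_sub_mulVec {a b m : ℕ} (A : LOO a) (B : LOO b)
    (ρ : Matrix (Fin a × Fin b) (Fin a × Fin b) ℂ) (p : Fin m → ℝ)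
    (ψ : Fin m → Fin a → ℂ) (φ : Fin m → Fin b → ℂ)
    (x : Fin (a ^ 2) → ℝ) (y : Fin (b ^ 2) → ℝ) :
    Sum.elim x y ⬝ᵥ (bipartiteCov A B ρ -
      Matrix.fromBlocks (∑ k, p k • covMatrix (ketbra (ψ k)) A.obs) 0 0
        (∑ k, p k • covMatrix (ketbra (φ k)) B.obs)) *ᵥ Sum.elim x y =
    variance ρ ((∑ i, (x i : ℂ) • A.obs i) ⊗ₖ (1 : Matrix (Fin b) (Fin b) ℂ) +
        (1 : Matrix (Fin a) (Fin a) ℂ) ⊗ₖ ∑ j, (y j : ℂ) • B.obs j) -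
      ∑ k, p k * (variance (ketbra (ψ k)) (∑ i, (x i : ℂ) • A.obs i) +
        variance (ketbra (φ k)) (∑ j, (y j : ℂ) • B.obs j)) := by
  rw [Matrix.sub_mulVec, dotProduct_sub, bipartiteCov, dotProduct_covMatrix_mulVec, sum_jointObs,
    Matrix.fromBlocks_mulVec, sumElim_dotProduct_sumElim]
  simp only [Sum.elim_comp_inl, Sum.elim_comp_inr, zero_mulVec, add_zero, zero_add, dotProduct_sum_covMatrix_mulVec, mul_add,
    Finset.sum_add_distrib]

/-- Trace-orthonormality makes the `d ^ 2` observables independent, hence a basis by dimension. The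
coefficients `tr (A_j H)` are real because both factors are Hermitian. -/
lemma LOO.exists_eq_sum {d : ℕ} (A : LOO d) {H : Matrix (Fin d) (Fin d) ℂ}
    (hH : H.IsHermitian) : ∃ x : Fin (d ^ 2) → ℝ, H = ∑ i, (x i : ℂ) • A.obs i := by
  have hc : ∀ (c : Fin (d ^ 2) → ℂ) j, (A.obs j * ∑ i, c i • A.obs i).trace = c j := by
    intro c j
    simp [Matrix.mul_sum, Matrix.trace_sum, A.orthonormal]
  have hli : LinearIndependent ℂ A.obs := by
    rw [Fintype.linearIndependent_iff]
    intro c h j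
    rw [← hc c j, h]
    simp
  have hspan := hli.span_eq_top_of_card_eq_finrank' (by
    rw [Module.finrank_matrix]; simp [sq])
  have hmem : H ∈ Submodule.span ℂ (Set.range A.obs) := hspan ▸ Submodule.mem_top
  obtain ⟨c, rfl⟩ := (Submodule.mem_span_range_iff_exists_fun ℂ).1 hmem
  refine ⟨fun i => (c i).re, Finset.sum_congr rfl fun j _ => ?_⟩
  congr 1
  refine (Complex.conj_eq_iff_re.1 ?_).symm
  have h := congrArg star (hc c j)
  rw [← Matrix.trace_conjTranspose, Matrix.conjTranspose_mul, hH.eq, (A.hermitian j).eq,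
    Matrix.trace_mul_comm, hc] at h
  exact h.symm

end Variance

/-! ### The entanglement parameter -/

lemma entParam_nonneg {a b : ℕ} (A : LOO a) (B : LOO b)
    {ρ : Matrix (Fin a × Fin b) (Fin a × Fin b) ℂ} (hρ : IsState ρ) : 0 ≤ entParam A B ρ :=
  sub_nonneg.2 (isGreatest_V A B hρ).1.1

/-- Attainment of the maximum is essential here: `V = 1` must make `t = 1` itself feasible, not just
a limit of feasible values. -/
lemma entParam_eq_zero_iff {a b : ℕ} (A : LOO a) (B : LOO b)
    {ρ : Matrix (Fin a × Fin b) (Fin a × Fin b) ℂ} (hρ : IsState ρ) :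
    entParam A B ρ = 0 ↔ SatisfiesCMC A B ρ := by
  have hV := isGreatest_V A B hρ
  constructor
  · intro h
    obtain ⟨-, κA, κB, hκ, hp⟩ := hV.1
    rw [← sub_eq_zero.1 h, one_smul] at hp
    exact ⟨κA, κB, hκ, hp⟩
  · rintro ⟨κA, κB, hκ, hp⟩
    exact sub_eq_zero.2 (le_antisymm (hV.2 ⟨le_rfl, κA, κB, hκ, by rwa [one_smul]⟩) hV.1.1)

lemma entParam_pos_iff {a b : ℕ} (A : LOO a) (B : LOO b)
    {ρ : Matrix (Fin a × Fin b) (Fin a × Fin b) ℂ} (hρ : IsState ρ) :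
    0 < entParam A B ρ ↔ ¬ SatisfiesCMC A B ρ := by
  rw [← entParam_eq_zero_iff A B hρ, (entParam_nonneg A B hρ).lt_iff_ne, ne_comm]

/-! ### Separability and the partial transpose -/

lemma IsSeparable.partialTranspose_posSemidef {a b : ℕ}
    {ρ : Matrix (Fin a × Fin b) (Fin a × Fin b) ℂ} (h : IsSeparable ρ) :
    (partialTranspose ρ).PosSemidef := by
  obtain ⟨n, p, ψ, φ, hp, -, -, -, rfl⟩ := h
  -- Transposing `|φ⟩⟨φ|` conjugates `φ`, so the partial transpose is again a nonnegative
  -- combination of product projectors.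
  have e : partialTranspose (∑ k, (p k : ℂ) • (ketbra (ψ k) ⊗ₖ ketbra (φ k))) =
      ∑ k, (p k : ℂ) • (ketbra (ψ k) ⊗ₖ ketbra (star (φ k))) := by
    ext ⟨i, j⟩ ⟨k, l⟩
    simp [partialTranspose, Matrix.sum_apply, ketbra, Matrix.vecMulVec_apply, mul_comm]
  rw [e]
  refine Matrix.posSemidef_sum _ fun k _ => Matrix.PosSemidef.smul ?_ ?_
  · exact (Matrix.posSemidef_vecMulVec_self_star _).kronecker
      (Matrix.posSemidef_vecMulVec_self_star _)
  · exact_mod_cast hp k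

/-! ### Two-qubit X-states -/

/-- The Hermitian qubit observable `x₀ 1 + x₁ σ_x + x₂ σ_y + x₃ σ_z`. -/
noncomputable def pauliComb (x₀ x₁ x₂ x₃ : ℝ) : Matrix (Fin 2) (Fin 2) ℂ :=
  !![⟨x₀ + x₃, 0⟩, ⟨x₁, -x₂⟩; ⟨x₁, x₂⟩, ⟨x₀ - x₃, 0⟩]

lemma pauliComb_isHermitian (x₀ x₁ x₂ x₃ : ℝ) : (pauliComb x₀ x₁ x₂ x₃).IsHermitian := by
  ext i j
  fin_cases i <;> fin_cases j <;> simp [pauliComb, Complex.ext_iff]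

lemma exists_eq_pauliComb {H : Matrix (Fin 2) (Fin 2) ℂ} (hH : H.IsHermitian) :
    ∃ x₀ x₁ x₂ x₃, H = pauliComb x₀ x₁ x₂ x₃ := by
  refine ⟨((H 0 0).re + (H 1 1).re) / 2, (H 1 0).re, (H 1 0).im,
    ((H 0 0).re - (H 1 1).re) / 2, ?_⟩
  have h00 := congrArg Complex.im (hH.apply 0 0)
  have h11 := congrArg Complex.im (hH.apply 1 1)
  have h01 := hH.apply 0 1
  simp at h00 h11
  ext i j
  fin_cases i <;> fin_cases j <;> simp [pauliComb, Complex.ext_iff, ← h01] <;>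
    constructor <;> linarith

/-- The matrix with diagonal `d₀, d₁, d₂, d₃` in the product basis and entry `z` between `00`
and `11`. -/
noncomputable def xState (d₀ d₁ d₂ d₃ z : ℝ) : Matrix (Fin 2 × Fin 2) (Fin 2 × Fin 2) ℂ :=
  Matrix.reindex finProdFinEquiv.symm finProdFinEquiv.symm
    (!![(d₀ : ℂ), 0, 0, z; 0, d₁, 0, 0; 0, 0, d₂, 0; z, 0, 0, d₃] : Matrix (Fin 4) (Fin 4) ℂ)

lemma xState_apply (d₀ d₁ d₂ d₃ z : ℝ) (i j k l : Fin 2) :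
    xState d₀ d₁ d₂ d₃ z (i, j) (k, l) =
      if i = k ∧ j = l then (if i = 0 then (if j = 0 then (d₀ : ℂ) else d₁)
        else (if j = 0 then (d₂ : ℂ) else d₃))
      else if i = j ∧ k = l then (z : ℂ) else 0 := by
  fin_cases i <;> fin_cases j <;> fin_cases k <;> fin_cases l <;> rfl

lemma trace_xState (d₀ d₁ d₂ d₃ z : ℝ) :
    (xState d₀ d₁ d₂ d₃ z).trace = ((d₀ + d₁ + d₂ + d₃ : ℝ) : ℂ) := by
  simp [Matrix.trace, Fintype.sum_prod_type, xState_apply]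
  ring

lemma smul_xState (c d₀ d₁ d₂ d₃ z : ℝ) :
    (c : ℂ) • xState d₀ d₁ d₂ d₃ z = xState (c * d₀) (c * d₁) (c * d₂) (c * d₃) (c * z) := by
  ext ⟨i, j⟩ ⟨k, l⟩
  fin_cases i <;> fin_cases j <;> fin_cases k <;> fin_cases l <;> simp [xState_apply]

/-- Subtracting `z` times the projector onto the unnormalised vector `00 + 11` leaves a nonnegative
diagonal matrix. The condition is sufficient, not necessary. -/
lemma xState_posSemidef {d₀ d₁ d₂ d₃ z : ℝ} (hz : 0 ≤ z) (h₀ : z ≤ d₀) (h₁ : 0 ≤ d₁)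
    (h₂ : 0 ≤ d₂) (h₃ : z ≤ d₃) : (xState d₀ d₁ d₂ d₃ z).PosSemidef := by
  let D : Fin 2 × Fin 2 → ℂ := fun x => ((!![d₀ - z, d₁; d₂, d₃ - z] x.1 x.2 : ℝ) : ℂ)
  let v : Fin 2 × Fin 2 → ℂ := fun x => if x.1 = x.2 then 1 else 0
  have e : xState d₀ d₁ d₂ d₃ z =
      Matrix.diagonal D + (z : ℂ) • Matrix.vecMulVec v (star v) := by
    ext ⟨i, j⟩ ⟨k, l⟩
    fin_cases i <;> fin_cases j <;> fin_cases k <;> fin_cases l <;>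
      simp [xState_apply, D, v, Matrix.vecMulVec_apply]
  rw [e]
  refine Matrix.PosSemidef.add (Matrix.PosSemidef.diagonal ?_)
    ((Matrix.posSemidef_vecMulVec_self_star v).smul (by exact_mod_cast hz))
  rintro ⟨i, j⟩
  have : (0 : ℝ) ≤ !![d₀ - z, d₁; d₂, d₃ - z] i j := by
    fin_cases i <;> fin_cases j <;> simp <;> assumption
  simpa [D] using this

lemma xState_isNPT {d₀ d₁ d₂ d₃ z : ℝ} (h₂ : 0 < d₂) (h : d₁ * d₂ < z ^ 2) :
    IsNPT (xState d₀ d₁ d₂ d₃ z) := by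
  intro hp
  -- Partial transposition moves `z` into the block `[[d₁, z], [z, d₂]]` on `01, 10`. On `(d₂, -z)`
  -- this block takes the value `d₂ (d₁ d₂ - z²) < 0`.
  have := (hp.dotProduct_mulVec_nonneg
    (fun x : Fin 2 × Fin 2 => ((!![0, d₂; -z, 0] x.1 x.2 : ℝ) : ℂ)))
  have := (Complex.le_def.1 this).1
  simp [dotProduct, Matrix.mulVec, Fintype.sum_prod_type, partialTranspose, xState_apply] at this
  nlinarith

set_option maxHeartbeats 1000000 in
lemma expect_xState_joint (d₀ d₁ d₂ d₃ z x₀ x₁ x₂ x₃ y₀ y₁ y₂ y₃ : ℝ) :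
    expect (xState d₀ d₁ d₂ d₃ z) (pauliComb x₀ x₁ x₂ x₃ ⊗ₖ (1 : Matrix (Fin 2) (Fin 2) ℂ) +
      (1 : Matrix (Fin 2) (Fin 2) ℂ) ⊗ₖ pauliComb y₀ y₁ y₂ y₃) =
    (d₀ + d₁ + d₂ + d₃) * (x₀ + y₀) + (d₀ + d₁ - d₂ - d₃) * x₃ + (d₀ - d₁ + d₂ - d₃) * y₃ := by
  simp [expect, Matrix.trace, Matrix.mul_apply, Fintype.sum_prod_type, xState_apply, pauliComb,
    Matrix.one_apply]
  ring

set_option maxHeartbeats 4000000 in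
lemma expect_xState_joint_sq (d₀ d₁ d₂ d₃ z x₀ x₁ x₂ x₃ y₀ y₁ y₂ y₃ : ℝ) :
    expect (xState d₀ d₁ d₂ d₃ z) ((pauliComb x₀ x₁ x₂ x₃ ⊗ₖ (1 : Matrix (Fin 2) (Fin 2) ℂ) +
      (1 : Matrix (Fin 2) (Fin 2) ℂ) ⊗ₖ pauliComb y₀ y₁ y₂ y₃) *
      (pauliComb x₀ x₁ x₂ x₃ ⊗ₖ (1 : Matrix (Fin 2) (Fin 2) ℂ) +
      (1 : Matrix (Fin 2) (Fin 2) ℂ) ⊗ₖ pauliComb y₀ y₁ y₂ y₃)) =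
    (d₀ + d₁ + d₂ + d₃) * ((x₀ + y₀) ^ 2 + x₁ ^ 2 + x₂ ^ 2 + x₃ ^ 2 + y₁ ^ 2 + y₂ ^ 2 + y₃ ^ 2) +
      2 * (x₀ + y₀) * ((d₀ + d₁ - d₂ - d₃) * x₃ + (d₀ - d₁ + d₂ - d₃) * y₃) +
      2 * (2 * z * x₁ * y₁ - 2 * z * x₂ * y₂ + (d₀ - d₁ - d₂ + d₃) * x₃ * y₃) := by
  simp [expect, Matrix.trace, Matrix.mul_apply, Fintype.sum_prod_type, xState_apply, pauliComb,
    Matrix.one_apply]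
  ring

/-- Unit trace removes the identity components `x₀`, `y₀`. The correlations are `2z`, `-2z` and `d₀
- d₁ - d₂ + d₃` along the three axes, and only the `σ_z` means are nonzero. -/
lemma variance_xState {d₀ d₁ d₂ d₃ : ℝ} (hd : d₀ + d₁ + d₂ + d₃ = 1)
    (z x₀ x₁ x₂ x₃ y₀ y₁ y₂ y₃ : ℝ) :
    variance (xState d₀ d₁ d₂ d₃ z) (pauliComb x₀ x₁ x₂ x₃ ⊗ₖ (1 : Matrix (Fin 2) (Fin 2) ℂ) +
      (1 : Matrix (Fin 2) (Fin 2) ℂ) ⊗ₖ pauliComb y₀ y₁ y₂ y₃) =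
    x₁ ^ 2 + x₂ ^ 2 + x₃ ^ 2 + y₁ ^ 2 + y₂ ^ 2 + y₃ ^ 2 +
      2 * (2 * z * x₁ * y₁ - 2 * z * x₂ * y₂ + (d₀ - d₁ - d₂ + d₃) * x₃ * y₃) -
      ((d₀ + d₁ - d₂ - d₃) * x₃ + (d₀ - d₁ + d₂ - d₃) * y₃) ^ 2 := by
  rw [variance, expect_xState_joint, expect_xState_joint_sq, hd]
  ring

/-- The variance of a qubit observable in the pure state `ψ`, in terms of the Bloch vector. -/
lemma variance_ketbra_pauliComb {ψ : Fin 2 → ℂ} (hψ : IsUnitVec ψ) (x₀ x₁ x₂ x₃ : ℝ) :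
    variance (ketbra ψ) (pauliComb x₀ x₁ x₂ x₃) = x₁ ^ 2 + x₂ ^ 2 + x₃ ^ 2 -
      (2 * ((ψ 0).re * (ψ 1).re + (ψ 0).im * (ψ 1).im) * x₁ +
        2 * ((ψ 0).re * (ψ 1).im - (ψ 0).im * (ψ 1).re) * x₂ +
        ((ψ 0).re ^ 2 + (ψ 0).im ^ 2 - (ψ 1).re ^ 2 - (ψ 1).im ^ 2) * x₃) ^ 2 := by
  have h := congrArg Complex.re hψ
  simp [dotProduct, Fin.sum_univ_two] at h
  simp [variance, expect, ketbra, Matrix.vecMulVec_apply, Matrix.trace, Matrix.mul_apply,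
    pauliComb]
  set a := (ψ 0).re
  set b := (ψ 0).im
  set c := (ψ 1).re
  set d := (ψ 1).im
  linear_combination (x₁ ^ 2 + x₂ ^ 2 + x₃ ^ 2 -
    x₀ ^ 2 * (a * a + b * b + c * c + d * d) +
    2 * x₀ * (x₃ * (c * c + d * d - a * a - b * b) - 2 * x₁ * (a * c + b * d) -
      2 * x₂ * (a * d - b * c))) * h

/-- The Bloch vector `r` of a pure state has length one, so the three variances add up to `3 - |r|²
= 2`. The signs allow `±σ` to be used as test observables. -/
lemma sum_variance_ketbra_pauli {ψ : Fin 2 → ℂ} (hψ : IsUnitVec ψ) (s t u : ℝ)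
    (hs : s ^ 2 = 1) (ht : t ^ 2 = 1) (hu : u ^ 2 = 1) :
    variance (ketbra ψ) (pauliComb 0 s 0 0) + variance (ketbra ψ) (pauliComb 0 0 t 0) +
      variance (ketbra ψ) (pauliComb 0 0 0 u) = 2 := by
  have h := congrArg Complex.re hψ
  simp [dotProduct, Fin.sum_univ_two] at h
  simp only [variance_ketbra_pauliComb hψ]
  set a := (ψ 0).re
  set b := (ψ 0).im
  set c := (ψ 1).re
  set d := (ψ 1).im
  ring_nf
  simp only [hs, ht, hu]
  linear_combination (-(a * a + b * b + (c * c + d * d)) - 1) * h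

/-- If the correlations of an X-state exceed what product states allow, then it is detected. -/
lemma not_satisfiesCMC_xState (A B : LOO 2) {d₀ d₁ d₂ d₃ z : ℝ} (hd : d₀ + d₁ + d₂ + d₃ = 1)
    (h : 1 < 4 * z + (d₀ - d₁ - d₂ + d₃)) : ¬ SatisfiesCMC A B (xState d₀ d₁ d₂ d₃ z) := by
  rintro ⟨_, _, ⟨n, p, ψ, φ, -, hs, hψ, hφ, rfl, rfl⟩, hpos⟩
  have key : ∀ x₁ x₂ x₃ y₁ y₂ y₃ : ℝ,
      ∑ k, p k * (variance (ketbra (ψ k)) (pauliComb 0 x₁ x₂ x₃) +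
        variance (ketbra (φ k)) (pauliComb 0 y₁ y₂ y₃)) ≤
      variance (xState d₀ d₁ d₂ d₃ z)
        (pauliComb 0 x₁ x₂ x₃ ⊗ₖ (1 : Matrix (Fin 2) (Fin 2) ℂ) +
          (1 : Matrix (Fin 2) (Fin 2) ℂ) ⊗ₖ pauliComb 0 y₁ y₂ y₃) := by
    intro x₁ x₂ x₃ y₁ y₂ y₃
    obtain ⟨x, hx⟩ := A.exists_eq_sum (pauliComb_isHermitian 0 x₁ x₂ x₃)
    obtain ⟨y, hy⟩ := B.exists_eq_sum (pauliComb_isHermitian 0 y₁ y₂ y₃)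
    have := hpos.dotProduct_mulVec_nonneg (Sum.elim x y)
    rw [star_trivial, dotProduct_bipartiteCov_sub_mulVec, ← hx, ← hy] at this
    linarith
  -- The test observables are `σ_x ⊗ 1 - 1 ⊗ σ_x`, `σ_y ⊗ 1 + 1 ⊗ σ_y` and `σ_z ⊗ 1 - 1 ⊗ σ_z`.
  -- Their relative signs make each correlation of `variance_xState` enter negatively.
  have h₁ := key 1 0 0 (-1) 0 0
  have h₂ := key 0 1 0 0 1 0
  have h₃ := key 0 0 1 0 0 (-1)
  have hsum : ∑ k, p k * (variance (ketbra (ψ k)) (pauliComb 0 1 0 0) +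
        variance (ketbra (φ k)) (pauliComb 0 (-1) 0 0)) +
      ∑ k, p k * (variance (ketbra (ψ k)) (pauliComb 0 0 1 0) +
        variance (ketbra (φ k)) (pauliComb 0 0 1 0)) +
      ∑ k, p k * (variance (ketbra (ψ k)) (pauliComb 0 0 0 1) +
        variance (ketbra (φ k)) (pauliComb 0 0 0 (-1))) = 4 := by
    rw [← Finset.sum_add_distrib, ← Finset.sum_add_distrib]
    trans ∑ k, p k * 4
    · refine Finset.sum_congr rfl fun k _ => ?_
      have e₁ := sum_variance_ketbra_pauli (hψ k) 1 1 1 (by norm_num) (by norm_num) (by norm_num)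
      have e₂ := sum_variance_ketbra_pauli (hφ k) (-1) 1 (-1) (by norm_num) (by norm_num)
        (by norm_num)
      linear_combination p k * (e₁ + e₂)
    · rw [← Finset.sum_mul, hs, one_mul]
  rw [variance_xState hd] at h₁ h₂ h₃
  -- The ensemble contributes 4, while the state gives `6 - 2 (4z + (d₀ - d₁ - d₂ + d₃))` minus this
  -- square, which is below 4.
  nlinarith [sq_nonneg ((d₀ + d₁ - d₂ - d₃) - (d₀ - d₁ + d₂ - d₃))]

/-! ### Local filtering with diagonal filters -/

/-- The X form survives, and `z²`, `d₁ d₂`, `d₀ d₃` all pick up the factor `(f₀ f₁ g₀ g₁)²`; only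
the balance within each pair changes. -/
lemma filter_xState (f₀ f₁ g₀ g₁ d₀ d₁ d₂ d₃ z : ℝ) :
    filter !![(f₀ : ℂ), 0; 0, (f₁ : ℂ)] !![(g₀ : ℂ), 0; 0, (g₁ : ℂ)] (xState d₀ d₁ d₂ d₃ z) =
      xState ((f₀ * g₀) ^ 2 * d₀) ((f₀ * g₁) ^ 2 * d₁) ((f₁ * g₀) ^ 2 * d₂)
        ((f₁ * g₁) ^ 2 * d₃) (f₀ * g₀ * (f₁ * g₁) * z) := by
  ext ⟨i, j⟩ ⟨k, l⟩
  fin_cases i <;> fin_cases j <;> fin_cases k <;> fin_cases l <;>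
    simp [filter, Matrix.mul_apply, Fintype.sum_prod_type, xState_apply] <;> ring

lemma prob_xState (f₀ f₁ g₀ g₁ d₀ d₁ d₂ d₃ z : ℝ) :
    prob !![(f₀ : ℂ), 0; 0, (f₁ : ℂ)] !![(g₀ : ℂ), 0; 0, (g₁ : ℂ)] (xState d₀ d₁ d₂ d₃ z) =
      (f₀ * g₀) ^ 2 * d₀ + (f₀ * g₁) ^ 2 * d₁ + (f₁ * g₀) ^ 2 * d₂ + (f₁ * g₁) ^ 2 * d₃ := by
  rw [prob, filter_xState, trace_xState, Complex.ofReal_re]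

lemma postState_isState {a b : ℕ} {ρ : Matrix (Fin a × Fin b) (Fin a × Fin b) ℂ}
    (hρ : ρ.PosSemidef) {F : Matrix (Fin a) (Fin a) ℂ} {G : Matrix (Fin b) (Fin b) ℂ}
    (h : 0 < prob F G ρ) : IsState (postState F G ρ) := by
  have hp : (filter F G ρ).PosSemidef := hρ.mul_mul_conjTranspose_same _
  refine ⟨hp.smul ?_, ?_⟩
  · rw [← Complex.ofReal_inv]
    exact_mod_cast (inv_pos.2 h).le
  -- `prob` keeps only the real part of the trace. Nothing is lost, since the trace of a positive
  -- semidefinite matrix is real.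
  · have e : (filter F G ρ).trace = (prob F G ρ : ℂ) :=
      Complex.ext rfl (by simpa using (Complex.le_def.1 hp.trace_nonneg).2.symm)
    rw [postState, Matrix.trace_smul, e, smul_eq_mul, inv_mul_cancel₀]
    exact_mod_cast h.ne'

/-! ### The example -/

lemma rhoEx_eq : rhoEx = xState 0.48508 0.33 0.00067 0.18425 0.02094 := by
  simp [rhoEx, xState]

lemma filterA_eq : filterA = !![((0.16457 : ℝ) : ℂ), 0; 0, ((0.98637 : ℝ) : ℂ)] := by
  ext i j
  fin_cases i <;> fin_cases j <;> simp [filterA]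

lemma filterB_eq : filterB = !![((0.96526 : ℝ) : ℂ), 0; 0, ((0.26128 : ℝ) : ℂ)] := by
  ext i j
  fin_cases i <;> fin_cases j <;> simp [filterB]

lemma isState_rhoEx : IsState rhoEx := by
  rw [rhoEx_eq]
  refine ⟨xState_posSemidef (by norm_num) (by norm_num) (by norm_num) (by norm_num)
    (by norm_num), ?_⟩
  rw [trace_xState]
  norm_num

lemma isNPT_rhoEx : IsNPT rhoEx := by
  rw [rhoEx_eq]
  exact xState_isNPT (by norm_num) (by norm_num)

/-- Eigenvectors of `σ_x`, `σ_y`, `σ_z` for the eigenvalue `1`. -/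
noncomputable def pauliKet : Fin 3 → Fin 2 → ℂ :=
  ![![⟨√2 / 2, 0⟩, ⟨√2 / 2, 0⟩], ![⟨√2 / 2, 0⟩, ⟨0, √2 / 2⟩], ![1, 0]]

lemma isUnitVec_pauliKet (k : Fin 3) : IsUnitVec (pauliKet k) := by
  have h : √2 / 2 * (√2 / 2) = (1 / 2 : ℝ) := by
    nlinarith [Real.mul_self_sqrt (show (0 : ℝ) ≤ 2 by norm_num)]
  fin_cases k <;>
    simp [IsUnitVec, pauliKet, dotProduct, Fin.sum_univ_two, Complex.ext_iff, h] <;> norm_num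

/-- The Bloch vectors are the coordinate axes, so each variance loses exactly one coordinate. -/
lemma variance_pauliKet (x₀ x₁ x₂ x₃ : ℝ) :
    variance (ketbra (pauliKet 0)) (pauliComb x₀ x₁ x₂ x₃) = x₂ ^ 2 + x₃ ^ 2 ∧
    variance (ketbra (pauliKet 1)) (pauliComb x₀ x₁ x₂ x₃) = x₁ ^ 2 + x₃ ^ 2 ∧
    variance (ketbra (pauliKet 2)) (pauliComb x₀ x₁ x₂ x₃) = x₁ ^ 2 + x₂ ^ 2 := by
  have h : √2 / 2 * (√2 / 2) = (1 / 2 : ℝ) := by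
    nlinarith [Real.mul_self_sqrt (show (0 : ℝ) ≤ 2 by norm_num)]
  simp only [variance_ketbra_pauliComb (isUnitVec_pauliKet _)]
  refine ⟨?_, ?_, ?_⟩ <;> simp [pauliKet, h] <;> ring

lemma satisfiesCMC_rhoEx (A B : LOO 2) : SatisfiesCMC A B rhoEx := by
  -- With weights `p_k` on the axes, the ensemble variance is the full square norm minus `∑ p_k
  -- (x_k² + y_k²)`, so each weight is slack along its own axis. The transverse axes need `p_k ≥ 2z
  -- = 0.04188`, met by 1/20; the rest goes to the `z` axis, where the strong correlation and the
  -- means must be absorbed.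
  refine ⟨_, _, ⟨3, ![1 / 20, 1 / 20, 9 / 10], pauliKet, pauliKet, ?_, ?_, isUnitVec_pauliKet,
    isUnitVec_pauliKet, rfl, rfl⟩, ?_⟩
  · intro k
    fin_cases k <;> norm_num
  · simp only [Fin.sum_univ_three, Matrix.cons_val]
    norm_num
  refine Matrix.PosSemidef.of_dotProduct_mulVec_nonneg ?_ fun v => ?_
  -- Over `ℝ` a nonnegative quadratic form does not force symmetry, so symmetry is checked
  -- separately.
  · refine Matrix.IsHermitian.sub ?_ (Matrix.IsHermitian.fromBlocks ?_ (by simp) ?_)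
    · exact (covMatrix_posSemidef isState_rhoEx (jointObs_isHermitian A B)).1
    · ext i j
      simp [Matrix.sum_apply, covMatrix, add_comm, mul_comm]
    · ext i j
      simp [Matrix.sum_apply, covMatrix, add_comm, mul_comm]
  obtain ⟨x, y, rfl⟩ : ∃ x y, v = Sum.elim x y := ⟨_, _, (Sum.elim_comp_inl_inr v).symm⟩
  have hH : ∀ (C : LOO 2) (w : Fin (2 ^ 2) → ℝ),
      (∑ i, (w i : ℂ) • C.obs i).IsHermitian := by
    intro C w
    rw [Matrix.IsHermitian, Matrix.conjTranspose_sum]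
    refine Finset.sum_congr rfl fun i _ => ?_
    rw [Matrix.conjTranspose_smul, (C.hermitian i).eq]
    simp
  obtain ⟨x₀, x₁, x₂, x₃, hx⟩ := exists_eq_pauliComb (hH A x)
  obtain ⟨y₀, y₁, y₂, y₃, hy⟩ := exists_eq_pauliComb (hH B y)
  rw [star_trivial, dotProduct_bipartiteCov_sub_mulVec, hx, hy, rhoEx_eq,
    variance_xState (by norm_num)]
  obtain ⟨a₀, a₁, a₂⟩ := variance_pauliKet x₀ x₁ x₂ x₃
  obtain ⟨b₀, b₁, b₂⟩ := variance_pauliKet y₀ y₁ y₂ y₃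
  rw [Fin.sum_univ_three, a₀, a₁, a₂, b₀, b₁, b₂]
  simp only [Matrix.cons_val]
  -- The difference splits into three binary forms, one for each pair `(x_k, y_k)`, and each is
  -- positive definite.
  nlinarith [sq_nonneg (x₁ + y₁), sq_nonneg (x₂ - y₂), sq_nonneg (x₁), sq_nonneg y₁,
    sq_nonneg (x₂), sq_nonneg y₂, sq_nonneg (x₃ + y₃), sq_nonneg x₃, sq_nonneg y₃]

lemma not_satisfiesCMC_filtered (A B : LOO 2) :
    ¬ SatisfiesCMC A B (postState filterA filterB rhoEx) := by
  rw [postState, rhoEx_eq, filterA_eq, filterB_eq, prob_xState, filter_xState,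
    ← Complex.ofReal_inv, smul_xState]
  -- Before normalisation `2z` is about 0.0017 and `d₁ + d₂` about 0.0012, with `d₁` and `d₂` nearly
  -- equal.
  refine not_satisfiesCMC_xState A B ?_ ?_ <;> norm_num

/-! ### The filtering protocol and its average. -/

lemma filterProtocol_outcomes : filterProtocol.outcomes =
    [(filterA, filterB), (filterA, filterBc), (filterAc, filterB), (filterAc, filterBc)] := by
  simp [filterProtocol, LOCC.outcomes, List.ofFn_succ]

lemma ofReal_sqrt_mul_self {x : ℝ} (hx : 0 ≤ x) : ((√x : ℝ) : ℂ) * (√x : ℝ) = x := by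
  rw [← Complex.ofReal_mul, Real.mul_self_sqrt hx]

lemma diag_mul_self (f₀ f₁ : ℂ) :
    !![f₀, 0; 0, f₁] * !![f₀, 0; 0, f₁] = !![f₀ * f₀, 0; 0, f₁ * f₁] := by
  simp

lemma filterAc_mul_self : filterAc * filterAc = 1 - filterA * filterA := by
  rw [filterAc, filterA, diag_mul_self, diag_mul_self, ofReal_sqrt_mul_self (by norm_num),
    ofReal_sqrt_mul_self (by norm_num)]
  ext i j
  fin_cases i <;> fin_cases j <;> simp [sq]

lemma filterBc_mul_self : filterBc * filterBc = 1 - filterB * filterB := by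
  rw [filterBc, filterB, diag_mul_self, diag_mul_self, ofReal_sqrt_mul_self (by norm_num),
    ofReal_sqrt_mul_self (by norm_num)]
  ext i j
  fin_cases i <;> fin_cases j <;> simp [sq]

lemma diag_posSemidef {f₀ f₁ : ℝ} (h₀ : 0 ≤ f₀) (h₁ : 0 ≤ f₁) :
    (!![(f₀ : ℂ), 0; 0, (f₁ : ℂ)]).PosSemidef := by
  have e : !![(f₀ : ℂ), 0; 0, (f₁ : ℂ)] = Matrix.diagonal ![(f₀ : ℂ), (f₁ : ℂ)] := by
    ext i j
    fin_cases i <;> fin_cases j <;> simp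
  rw [e]
  refine Matrix.PosSemidef.diagonal fun i => ?_
  fin_cases i <;> simpa

lemma filterAc_posSemidef : filterAc.PosSemidef :=
  diag_posSemidef (Real.sqrt_nonneg _) (Real.sqrt_nonneg _)

lemma filterBc_posSemidef : filterBc.PosSemidef :=
  diag_posSemidef (Real.sqrt_nonneg _) (Real.sqrt_nonneg _)

lemma filterProtocol_isValid : filterProtocol.IsValid := by
  have hA : filterA.conjTranspose = filterA := by
    rw [filterA_eq]
    exact (diag_posSemidef (by norm_num) (by norm_num)).1
  have hB : filterB.conjTranspose = filterB := by
    rw [filterB_eq]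
    exact (diag_posSemidef (by norm_num) (by norm_num)).1
  have hAc : filterAc.conjTranspose = filterAc := filterAc_posSemidef.1
  have hBc : filterBc.conjTranspose = filterBc := filterBc_posSemidef.1
  refine ⟨?_, fun i => ⟨?_, fun j => trivial⟩⟩
  · simp [Fin.sum_univ_two, hA, hAc, filterAc_mul_self]
  · simp [Fin.sum_univ_two, hB, hBc, filterBc_mul_self]

lemma prob_diag_rhoEx_pos {f₀ f₁ g₀ g₁ : ℝ} (hf₀ : 0 < f₀) (hf₁ : 0 < f₁) (hg₀ : 0 < g₀)
    (hg₁ : 0 < g₁) :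
    0 < prob !![(f₀ : ℂ), 0; 0, (f₁ : ℂ)] !![(g₀ : ℂ), 0; 0, (g₁ : ℂ)] rhoEx := by
  rw [rhoEx_eq, prob_xState]
  positivity

lemma prob_pos_of_mem_outcomes {FG : Matrix (Fin 2) (Fin 2) ℂ × Matrix (Fin 2) (Fin 2) ℂ}
    (h : FG ∈ filterProtocol.outcomes) : 0 < prob FG.1 FG.2 rhoEx := by
  rw [filterProtocol_outcomes] at h
  simp only [List.mem_cons, List.not_mem_nil, or_false] at h
  rcases h with rfl | rfl | rfl | rfl
  all_goals
    simp only [filterA_eq, filterB_eq, filterAc, filterBc]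
    apply prob_diag_rhoEx_pos
  all_goals first | exact Real.sqrt_pos.2 (by norm_num) | norm_num

lemma average_pos (A B : LOO 2) : 0 < filterProtocol.average (entParam A B) rhoEx := by
  have hp := @prob_pos_of_mem_outcomes
  have hE := fun {FG} (h : FG ∈ filterProtocol.outcomes) =>
    entParam_nonneg A B (postState_isState isState_rhoEx.1 (hp h))
  have h₁ : (filterA, filterB) ∈ filterProtocol.outcomes := by simp [filterProtocol_outcomes]
  have hpos := (entParam_pos_iff A B (postState_isState isState_rhoEx.1 (hp h₁))).2
    (not_satisfiesCMC_filtered A B)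
  rw [LOCC.average]
  refine lt_of_lt_of_le (mul_pos (hp h₁) hpos) (List.single_le_sum ?_ _
    (List.mem_map.2 ⟨_, h₁, rfl⟩))
  intro x hx
  obtain ⟨FG, hFG, rfl⟩ := List.mem_map.1 hx
  exact mul_nonneg (hp hFG).le (hE hFG)

end CMC

theorem mainTheorem9 (A B : CMC.LOO 2) :
    -- the example is an NPT (hence entangled) two-qubit state that the criterion does not detect
    CMC.IsState CMC.rhoEx ∧ CMC.IsNPT CMC.rhoEx ∧ ¬ CMC.IsSeparable CMC.rhoEx ∧
    CMC.SatisfiesCMC A B CMC.rhoEx ∧ CMC.entParam A B CMC.rhoEx = 0 ∧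
    -- the complementary filters are the positive square roots of `1 - F²`
    CMC.filterAc.PosSemidef ∧
    CMC.filterAc * CMC.filterAc = 1 - CMC.filterA * CMC.filterA ∧
    CMC.filterBc.PosSemidef ∧
    CMC.filterBc * CMC.filterBc = 1 - CMC.filterB * CMC.filterB ∧
    -- the filtering is a legitimate LOCC protocol with four outcomes
    CMC.filterProtocol.IsValid ∧
    CMC.filterProtocol.outcomes = [(CMC.filterA, CMC.filterB), (CMC.filterA, CMC.filterBc),
      (CMC.filterAc, CMC.filterB), (CMC.filterAc, CMC.filterBc)] ∧
    -- each outcome has positive probability and is a state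
    (∀ FG ∈ CMC.filterProtocol.outcomes, 0 < CMC.prob FG.1 FG.2 CMC.rhoEx ∧
      CMC.IsState (CMC.postState FG.1 FG.2 CMC.rhoEx)) ∧
    -- the filtered outcome is detected by the criterion
    ¬ CMC.SatisfiesCMC A B (CMC.postState CMC.filterA CMC.filterB CMC.rhoEx) ∧
    0 < CMC.entParam A B (CMC.postState CMC.filterA CMC.filterB CMC.rhoEx) ∧
    -- the parameter increases on average, from zero to a positive value
    CMC.entParam A B CMC.rhoEx <
      CMC.filterProtocol.average (CMC.entParam A B) CMC.rhoEx := by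
  have hE := (CMC.entParam_eq_zero_iff A B CMC.isState_rhoEx).2 (CMC.satisfiesCMC_rhoEx A B)
  have hO : ∀ FG ∈ CMC.filterProtocol.outcomes, 0 < CMC.prob FG.1 FG.2 CMC.rhoEx ∧
      CMC.IsState (CMC.postState FG.1 FG.2 CMC.rhoEx) := fun FG h =>
    ⟨CMC.prob_pos_of_mem_outcomes h,
      CMC.postState_isState CMC.isState_rhoEx.1 (CMC.prob_pos_of_mem_outcomes h)⟩
  have hS := (hO (CMC.filterA, CMC.filterB) (by simp [CMC.filterProtocol_outcomes])).2
  exact ⟨CMC.isState_rhoEx, CMC.isNPT_rhoEx,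
    fun h => CMC.isNPT_rhoEx h.partialTranspose_posSemidef, CMC.satisfiesCMC_rhoEx A B, hE,
    CMC.filterAc_posSemidef, CMC.filterAc_mul_self, CMC.filterBc_posSemidef,
    CMC.filterBc_mul_self, CMC.filterProtocol_isValid, CMC.filterProtocol_outcomes, hO,
    CMC.not_satisfiesCMC_filtered A B,
    (CMC.entParam_pos_iff A B hS).2 (CMC.not_satisfiesCMC_filtered A B),
    hE ▸ CMC.average_pos A B⟩
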